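/- Let $B:[0,\infty)^2\to[0,\infty)$ be symmetric, $B(x,y)=B(y,x)$, and continuous on $[0,\infty)^2\setminus\{(0,0)\}$. Assume that there are constants $\theta\in(0,1)$, $\delta_*>0$, $\rho_*>0$ and $C_*>0$ such that the support of $B$ (the closure of $\{B\neq0\}$ in $[0,\infty)^2$) is $\Gamma=\Gamma_1\cup\Gamma_2$, where $$\Gamma_1=\{(x,y)\in[0,\infty)^2\setminus[0,\delta_*]^2:\ \theta x\le y\le\theta^{-1}x\},\qquad \Gamma_2=\{(x,y)\in[0,\delta_*]^2:\ |x-y|\le\rho_*\sqrt{xy(x+y)}\},$$ and $$B(x,y)\le B\Big(\tfrac{x+y}2,\tfrac{x+y}2\Big)\le\frac{C_*e^{\frac{x+y}2}}{x+y}\qquad\text{for all }(x,y)\in\Gamma\setminus\{(0,0)\}.$$ Put $b(x,y)=\frac{B(x,y)}{xy}$ and $R(x,y)=b(x,y)(e^{-x}-e^{-y})$, with $b=0$ on the axes. Let $\mathscr M_+([0,\infty))$ be the space of nonnegative finite Borel measures on $[0,\infty)$ with the narrow topology (weak convergence against $C_b([0,\infty))$). For $\mu\in\mathscr M_+([0,\infty))$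 write $M_0(\mu)=\mu([0,\infty))$ and $X_\eta(\mu)=\int_{[0,\infty)}e^{\eta x}\,d\mu(x)\in[0,\infty]$. Let $C_b^1([0,\infty))$ be the space of bounded $C^1$ functions on $[0,\infty)$ with bounded derivative. **Theorem.** Let $u_0\in\mathscr M_+([0,\infty))$ satisfy $X_\eta(u_0)<\infty$ for some $\eta>\frac{1-\theta}2$. Then there exists $u\in C([0,\infty),\mathscr M_+([0,\infty)))$ which is a weak solution of $$\frac{\partial u}{\partial t}(t,x)=u(t,x)\int_0^\infty R(x,y)\,u(t,y)\,dy$$ with initial datum $u_0$, that is: (i) for all $\varphi\in C_b([0,\infty))$, the map $t\mapsto\int_{[0,\infty)}\varphi(x)\,u(t,dx)$ is continuous on $[0,\infty)$, and $\int_{[0,\infty)}\varphi(x)\,u(0,dx)=\int_{[0,\infty)}\varphi(x)\,u_0(dx)$; (ii) for all $\varphi\in C^1_b([0,\infty))$ with $\varphi'(0)=0$, the map $t\mapsto\int_{[0,\infty)}\varphi(x)\,u(t,dx)$ belongs to $W^{1,\infty}_{loc}([0,\infty);\mathbb R)$, and for almost every $t>0$ the double integral below converges absolutely and $$\frac{d}{dt}\int_{[0,\infty)}\varphi(x)\,u(t,dx)=\frac12\iint_{[0,\infty)^2}R(x,y)\big(\varphi(x)-\varphi(y)\big)\,u(t,dx)\,u(t,dy).$$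 Moreover, $M_0(u(t))=M_0(u_0)$ and $X_\eta(u(t))\le X_\eta(u_0)$ for all $t\ge0$. -/

import Mathlib

open MeasureTheory Set Filter Topology
open scoped NNReal ENNReal BoundedContinuousFunction ContDiff

noncomputable section

namespace Compton

/-- The part of the support region that lies outside the square `[0, δ]²`: the cone
`θ x ≤ y ≤ θ⁻¹ x`. -/
def gammaOne (θ δ : ℝ) : Set (ℝ≥0 × ℝ≥0) :=
  {p | ¬((p.1 : ℝ) ≤ δ ∧ (p.2 : ℝ) ≤ δ) ∧
    θ * (p.1 : ℝ) ≤ (p.2 : ℝ) ∧ (p.2 : ℝ) ≤ θ⁻¹ * (p.1 : ℝ)}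

/-- The part of the support region that lies in the square `[0, δ]²`. -/
def gammaTwo (δ ρ : ℝ) : Set (ℝ≥0 × ℝ≥0) :=
  {p | ((p.1 : ℝ) ≤ δ ∧ (p.2 : ℝ) ≤ δ) ∧
    |(p.1 : ℝ) - (p.2 : ℝ)| ≤ ρ * √((p.1 : ℝ) * (p.2 : ℝ) * ((p.1 : ℝ) + (p.2 : ℝ)))}

/-- The support region `Γ = Γ₁ ∪ Γ₂`. -/
def gammaRegion (θ δ ρ : ℝ) : Set (ℝ≥0 × ℝ≥0) :=
  gammaOne θ δ ∪ gammaTwo δ ρ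

/-- The standing assumptions on the truncated redistribution function `B` on `[0, ∞)²`.
The growth bound is imposed away from the origin, where its right-hand side is finite. -/
structure IsKernel (B : ℝ≥0 → ℝ≥0 → ℝ) (θ δ ρ C : ℝ) : Prop where
  theta_pos : 0 < θ
  theta_lt_one : θ < 1
  delta_pos : 0 < δ
  rho_pos : 0 < ρ
  const_pos : 0 < C
  nonneg : ∀ x y, 0 ≤ B x y
  symm : ∀ x y, B x y = B y x
  continuousOn : ContinuousOn (fun p : ℝ≥0 × ℝ≥0 => B p.1 p.2) {((0 : ℝ≥0), (0 : ℝ≥0))}ᶜ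
  support_eq : tsupport (fun p : ℝ≥0 × ℝ≥0 => B p.1 p.2) = gammaRegion θ δ ρ
  le_diag : ∀ x y : ℝ≥0, (x, y) ∈ gammaRegion θ δ ρ → (x, y) ≠ (0, 0) →
    B x y ≤ B ((x + y) / 2) ((x + y) / 2)
  diag_le : ∀ x y : ℝ≥0, (x, y) ∈ gammaRegion θ δ ρ → (x, y) ≠ (0, 0) →
    B ((x + y) / 2) ((x + y) / 2) ≤
      C * Real.exp (((x : ℝ) + (y : ℝ)) / 2) / ((x : ℝ) + (y : ℝ))

/-- `b(x, y) = B(x, y) / (x y)`. Under `IsKernel` the function `B` vanishes on both axes away from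
the origin, and there `b` takes the value `0`. -/
def kernelb (B : ℝ≥0 → ℝ≥0 → ℝ) (x y : ℝ≥0) : ℝ :=
  B x y / ((x : ℝ) * (y : ℝ))

/-- `R(x, y) = b(x, y) (e⁻ˣ - e⁻ʸ)`. -/
def kernelR (B : ℝ≥0 → ℝ≥0 → ℝ) (x y : ℝ≥0) : ℝ :=
  kernelb B x y * (Real.exp (-(x : ℝ)) - Real.exp (-(y : ℝ)))

/-- The exponential moment `X_η(μ) = ∫ e^{η x} dμ(x)`, with values in `[0, ∞]`. -/
def expMoment (η : ℝ) (μ : FiniteMeasure ℝ≥0) : ℝ≥0∞ :=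
  ∫⁻ x : ℝ≥0, ENNReal.ofReal (Real.exp (η * (x : ℝ))) ∂(μ : Measure ℝ≥0)

/-- `φ ∈ C¹_b([0, ∞))`; the derivative at `0` is one-sided, and only the values of `φ` on
`[0, ∞)` matter. -/
structure IsC1b (φ : ℝ → ℝ) : Prop where
  contDiffOn : ContDiffOn ℝ 1 φ (Ici 0)
  bounded : ∃ M : ℝ, ∀ x ∈ Ici (0 : ℝ), |φ x| ≤ M
  deriv_bounded : ∃ M : ℝ, ∀ x ∈ Ici (0 : ℝ), |derivWithin φ (Ici 0) x| ≤ M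

/-- `f ∈ L^∞_loc([0, ∞))`: essentially bounded on `(0, T)` for every `T`. -/
def MemLinftyLoc (f : ℝ → ℝ) : Prop :=
  ∀ T : ℝ, 0 < T → MemLp f ⊤ (volume.restrict (Ioo 0 T))

/-- `g` is the weak derivative of `f` on `(0, ∞)`. -/
def IsWeakDeriv (f g : ℝ → ℝ) : Prop :=
  ∀ ψ : ℝ → ℝ, ContDiff ℝ ∞ ψ → HasCompactSupport ψ → tsupport ψ ⊆ Ioi 0 →
    ∫ t in Ioi (0 : ℝ), f t * deriv ψ t = -∫ t in Ioi (0 : ℝ), g t * ψ t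

/-- `f ∈ W^{1,∞}_loc([0, ∞))`. -/
def MemW1inftyLoc (f : ℝ → ℝ) : Prop :=
  MemLinftyLoc f ∧ ∃ g : ℝ → ℝ, MemLinftyLoc g ∧ IsWeakDeriv f g

/-- The function `t ↦ ∫ φ(x) u(t, x) dx` of real time (only `t ≥ 0` matters). -/
def pairing (u : ℝ≥0 → FiniteMeasure ℝ≥0) (φ : ℝ → ℝ) (t : ℝ) : ℝ :=
  ∫ x : ℝ≥0, φ (x : ℝ) ∂(u t.toNNReal : Measure ℝ≥0)

/-- The integrand `R(x, y) (φ(x) - φ(y))` of the quadratic collision operator in weak form. -/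
def collisionIntegrand (B : ℝ≥0 → ℝ≥0 → ℝ) (φ : ℝ → ℝ) (p : ℝ≥0 × ℝ≥0) : ℝ :=
  kernelR B p.1 p.2 * (φ (p.1 : ℝ) - φ (p.2 : ℝ))

/-- `u` is a weak solution of `∂ₜu(t, x) = u(t, x) ∫ R(x, y) u(t, y) dy` with initial datum
`u₀`. -/
structure IsWeakSolution (B : ℝ≥0 → ℝ≥0 → ℝ) (u₀ : FiniteMeasure ℝ≥0)
    (u : ℝ≥0 → FiniteMeasure ℝ≥0) : Prop where
  continuous_integral : ∀ φ : ℝ≥0 →ᵇ ℝ,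
    Continuous (fun t : ℝ≥0 => ∫ x, φ x ∂(u t : Measure ℝ≥0))
  initial : ∀ φ : ℝ≥0 →ᵇ ℝ,
    ∫ x, φ x ∂(u 0 : Measure ℝ≥0) = ∫ x, φ x ∂(u₀ : Measure ℝ≥0)
  memW1inftyLoc : ∀ φ : ℝ → ℝ, IsC1b φ → derivWithin φ (Ici 0) 0 = 0 →
    MemW1inftyLoc (pairing u φ)
  equation : ∀ φ : ℝ → ℝ, IsC1b φ → derivWithin φ (Ici 0) 0 = 0 →
    ∀ᵐ t ∂(volume.restrict (Ioi (0 : ℝ))),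
      Integrable (collisionIntegrand B φ)
        ((u t.toNNReal : Measure ℝ≥0).prod (u t.toNNReal : Measure ℝ≥0)) ∧
      HasDerivAt (pairing u φ)
        ((1 / 2 : ℝ) * ∫ p : ℝ≥0 × ℝ≥0, collisionIntegrand B φ p
          ∂((u t.toNNReal : Measure ℝ≥0).prod (u t.toNNReal : Measure ℝ≥0))) t

end Compton

end

/-
Truncate `b` at height `n` and solve the resulting equation with bounded rate by explicit Euler
steps. The antisymmetry of the rate conserves mass, and since the rate is nonnegative for `x ≤ y`
mass only moves towards the origin, so moments of increasing weights do not increase. All iterates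
thus lie in the compact set of measures of mass `M₀(u₀)` whose `η`-moment is at most `X_η(u₀)`, and
any limit along an ultrafilter of the piecewise constant interpolations is a solution once the
quadratic forms converge uniformly on this set. For this the only obstructions are the origin and
infinity. At the origin `R(x, y) = O(|x - y|⁻¹)`, which `φ'(0) = 0` compensates, because then
`φ(x) - φ(y) = o(|x - y|)`; at infinity `R(x, y) = O(e^{(1 - θ) max(x, y) / 2})`, which the moment
controls.
-/

open Asymptotics

noncomputable section

namespace Compton

section Compactness

variable {X ι : Type*} [TopologicalSpace X] {K : Set X} {p : ι → X → ℝ}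

theorem tendsto_nhds_of_injOn_compact {α : Type*} {l : Filter α} {f : α → X} {x : X}
    (hK : IsCompact K) (hp : ∀ i, Continuous (p i)) (hinj : InjOn (fun x i => p i x) K)
    (hfK : ∀ᶠ a in l, f a ∈ K) (hx : x ∈ K)
    (hlim : ∀ i, Tendsto (fun a => p i (f a)) l (𝓝 (p i x))) : Tendsto f l (𝓝 x) := by
  refine hK.tendsto_nhds_of_unique_mapClusterPt hfK fun y hyK hy => hinj hyK hx (funext fun i => ?_)
  have hpy : ClusterPt (p i y) (map (p i ∘ f) l) :=
    MapClusterPt.continuousAt_comp (hp i).continuousAt hy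
  exact eq_of_nhds_neBot (hpy.mono (hlim i))

theorem tendsto_of_tendsto_nhds_prod {T α Y : Type*} [TopologicalSpace T] {l : Filter α}
    {l' : Filter Y} {w : T → α → Y} {t : T}
    (h : Tendsto (fun z : T × α => w z.1 z.2) (𝓝 t ×ˢ l) l') : Tendsto (w t) l l' :=
  h.comp ((tendsto_const_nhds (x := t)).prodMk tendsto_id)

theorem continuous_of_tendsto_prod {T α Y : Type*} [TopologicalSpace T] [TopologicalSpace Y]
    [RegularSpace Y] {l : Filter α} [NeBot l] {w : T → α → Y} {u : T → Y}
    (h : ∀ t, Tendsto (fun z : T × α => w z.1 z.2) (𝓝 t ×ˢ l) (𝓝 (u t))) : Continuous u := by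
  refine continuous_iff_continuousAt.2 fun t => (closed_nhds_basis (u t)).tendsto_right_iff.2 ?_
  rintro V ⟨hV, hVclosed⟩
  filter_upwards [((h t).eventually hV).curry] with s hs
  exact hVclosed.mem_of_tendsto (tendsto_of_tendsto_nhds_prod (h s)) hs

theorem exists_continuous_ultrafilter_limit {T α : Type*} [TopologicalSpace T] {U : Ultrafilter α}
    {w : T → α → X} (hK : IsCompact K) (hp : ∀ i, Continuous (p i))
    (hinj : InjOn (fun x i => p i x) K) (hw : ∀ t a, w t a ∈ K)
    (hequi : ∀ i t, Tendsto (fun z : T × α => p i (w z.1 z.2) - p i (w t z.2)) (𝓝 t ×ˢ U) (𝓝 0)) :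
    ∃ u : T → X, Continuous u ∧ (∀ t, u t ∈ K) ∧
      ∀ t, Tendsto (fun z : T × α => w z.1 z.2) (𝓝 t ×ˢ U) (𝓝 (u t)) := by
  have hpt (t : T) : ∃ x ∈ K, Tendsto (w t) U (𝓝 x) :=
    hK.ultrafilter_le_nhds' (U.map (w t)) (Ultrafilter.mem_map.2 (Eventually.of_forall (hw t)))
  choose u huK hu using hpt
  have hjoint (i : ι) (t : T) :
      Tendsto (fun z : T × α => p i (w z.1 z.2)) (𝓝 t ×ˢ U) (𝓝 (p i (u t))) := by
    simpa using (hequi i t).add (((hp i).tendsto (u t)).comp ((hu t).comp tendsto_snd))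
  refine ⟨u, continuous_iff_continuousAt.2 fun t => ?_, huK, fun t => ?_⟩
  · exact tendsto_nhds_of_injOn_compact hK hp hinj (Eventually.of_forall huK) (huK t) fun i =>
      (continuous_of_tendsto_prod (w := fun s a => p i (w s a)) (hjoint i)).tendsto t
  · exact tendsto_nhds_of_injOn_compact hK hp hinj (Eventually.of_forall fun z => hw z.1 z.2)
      (huK t) fun i => hjoint i t

end Compactness

section OneStepSchemes

theorem floor_div_mul_mem_Ioc {h r : ℝ} (hh : 0 < h) (hr : 0 ≤ r) :
    (⌊r / h⌋₊ * h : ℝ) ∈ Ioc (r - h) r := by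
  have hle := Nat.floor_le (div_nonneg hr hh.le)
  have hlt := Nat.lt_floor_add_one (r / h)
  rw [le_div_iff₀ hh] at hle
  rw [div_lt_iff₀ hh] at hlt
  exact ⟨by linarith, hle⟩

theorem abs_sub_floor_sub_le {P : ℕ → ℝ} {h c ε s t : ℝ} (hh : 0 < h) (hε : 0 ≤ ε) (hs : 0 ≤ s)
    (ht : 0 ≤ t) (hP : ∀ m : ℕ, (m * h : ℝ) ∈ Ioc (min s t - h) (max s t) →
      |P (m + 1) - P m - h * c| ≤ ε * h) :
    |P ⌊s / h⌋₊ - P ⌊t / h⌋₊ - (s - t) * c| ≤ |s - t| * ε + (|c| + ε) * h := by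
  wlog hst : t ≤ s generalizing s t
  · have hts := this ht hs (by rwa [min_comm, max_comm]) (le_of_not_ge hst)
    rwa [← abs_neg, abs_sub_comm s, show -(P ⌊s / h⌋₊ - P ⌊t / h⌋₊ - (s - t) * c) =
      P ⌊t / h⌋₊ - P ⌊s / h⌋₊ - (t - s) * c by ring]
  rw [min_eq_right hst, max_eq_left hst] at hP
  obtain ⟨hs₂, hs₁⟩ := floor_div_mul_mem_Ioc hh hs
  obtain ⟨ht₂, ht₁⟩ := floor_div_mul_mem_Ioc hh ht
  have hab : ⌊t / h⌋₊ ≤ ⌊s / h⌋₊ := Nat.floor_le_floor (by gcongr)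
  set a := ⌊t / h⌋₊
  set b := ⌊s / h⌋₊
  have hstep {m : ℕ} (ham : a ≤ m) (hmb : m < b) :
      dist (P m - m * (h * c)) (P (m + 1) - (m + 1 : ℕ) * (h * c)) ≤ ε * h := by
    have ham' : (a * h : ℝ) ≤ m * h := by gcongr
    have hmb' : (m * h : ℝ) ≤ b * h := by gcongr
    convert hP m ⟨by linarith, by linarith⟩ using 1
    rw [dist_comm, Real.dist_eq]
    push_cast
    ring_nf
  have hsum := dist_le_Ico_sum_of_dist_le hab hstep
  rw [Finset.sum_const, Nat.card_Ico, nsmul_eq_mul, Nat.cast_sub hab, dist_comm,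
    Real.dist_eq] at hsum
  have hround : |(b - a) * h - (s - t)| ≤ h := abs_le.2 ⟨by linarith, by linarith⟩
  calc |P b - P a - (s - t) * c|
      = |(P b - b * (h * c) - (P a - a * (h * c))) + ((b - a) * h - (s - t)) * c| := by ring_nf
    _ ≤ (b - a) * (ε * h) + h * |c| := by
        refine (abs_add_le _ _).trans (add_le_add hsum ?_)
        rw [abs_mul]
        gcongr
    _ ≤ (s - t + h) * ε + h * |c| := by
        linarith [mul_le_mul_of_nonneg_right (show (b - a) * h ≤ s - t + h by linarith) hε]
    _ = |s - t| * ε + (|c| + ε) * h := by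
        rw [abs_of_nonneg (sub_nonneg.2 hst)]
        ring

/-- The piecewise constant interpolation in time of the iterates `v n k` of a family of one-step
schemes with time steps `h n`. -/
def stepCurve {α X : Type*} (h : α → ℝ) (v : α → ℕ → X) (t : ℝ≥0) (a : α) : X :=
  v a ⌊(t : ℝ) / h a⌋₊

/-- Consistency of the schemes `v` with `d/dt p(u) = Q(u)`: the one-step error, measured through
the observable `p`, is `o(h)` uniformly along the iterates. -/
def IsConsistent {α X : Type*} (l : Filter α) (h : α → ℝ) (v : α → ℕ → X) (p Q : X → ℝ) : Prop :=
  ∀ ε > 0, ∀ᶠ a in l, ∀ k, |p (v a (k + 1)) - p (v a k) - h a * Q (v a k)| ≤ ε * h a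

variable {α X : Type*} [TopologicalSpace X] {l : Filter α} {h : α → ℝ} {v : α → ℕ → X} {K : Set X}
  {p Q : X → ℝ}

theorem IsConsistent.tendsto_stepCurve_sub (hpQ : IsConsistent l h v p Q) (hK : IsCompact K)
    (hQ : ContinuousOn Q K) (hv : ∀ a k, v a k ∈ K) (hh : ∀ a, 0 < h a) (hlim : Tendsto h l (𝓝 0))
    (t : ℝ≥0) :
    Tendsto (fun z : ℝ≥0 × α => p (stepCurve h v z.1 z.2) - p (stepCurve h v t z.2))
      (𝓝 t ×ˢ l) (𝓝 0) := by
  obtain ⟨L, hL⟩ := hK.exists_bound_of_continuousOn hQ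
  simp only [Real.norm_eq_abs] at hL
  have hbound : ∀ᶠ z : ℝ≥0 × α in 𝓝 t ×ˢ l,
      ‖p (stepCurve h v z.1 z.2) - p (stepCurve h v t z.2)‖ ≤
        |(z.1 : ℝ) - t| * (|L| + 1) + (|0| + (|L| + 1)) * h z.2 := by
    filter_upwards [tendsto_snd.eventually (hpQ 1 one_pos)] with ⟨s, a⟩ ha
    have hstep (m : ℕ) : |p (v a (m + 1)) - p (v a m) - h a * 0| ≤ (|L| + 1) * h a := by
      have hQm : |h a * Q (v a m)| ≤ h a * |L| := by
        rw [abs_mul, abs_of_pos (hh a)]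
        exact mul_le_mul_of_nonneg_left ((hL _ (hv a m)).trans (le_abs_self L)) (hh a).le
      have htri := abs_sub_le (p (v a (m + 1)) - p (v a m)) (h a * Q (v a m)) 0
      simp only [sub_zero] at htri
      rw [mul_zero, sub_zero]
      linarith [ha m]
    simpa [stepCurve] using abs_sub_floor_sub_le (s := s) (t := t) (P := fun m => p (v a m))
      (hh a) (by positivity) s.2 t.2 fun m _ => hstep m
  have hsub : Tendsto (fun s : ℝ≥0 => |(s : ℝ) - t|) (𝓝 t) (𝓝 0) :=
    Continuous.tendsto' (by fun_prop) t 0 (by simp)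
  refine squeeze_zero_norm' hbound ?_
  simpa using ((hsub.comp tendsto_fst).mul_const (|L| + 1)).add
    ((hlim.comp tendsto_snd).const_mul (|0| + (|L| + 1)))

theorem IsConsistent.exists_abs_stepCurve_sub_le (hpQ : IsConsistent l h v p Q)
    (hQ : ContinuousOn Q K) (hv : ∀ a k, v a k ∈ K) (hh : ∀ a, 0 < h a) (hlim : Tendsto h l (𝓝 0))
    {t : ℝ≥0} {x : X} (hx : x ∈ K)
    (hu : Tendsto (fun z : ℝ≥0 × α => stepCurve h v z.1 z.2) (𝓝 t ×ˢ l) (𝓝 x))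
    {ε : ℝ} (hε : 0 < ε) :
    ∃ r > 0, ∀ᶠ a in l, ∀ s : ℝ≥0, dist s t < r →
      |p (stepCurve h v s a) - p (stepCurve h v t a) - (s - t) * Q x| ≤
        |(s : ℝ) - t| * ε + (|Q x| + ε) * h a := by
  have hQlim : Tendsto (fun z : ℝ≥0 × α => Q (stepCurve h v z.1 z.2)) (𝓝 t ×ˢ l) (𝓝 (Q x)) :=
    (hQ x hx).tendsto.comp (tendsto_nhdsWithin_iff.2 ⟨hu, Eventually.of_forall fun z => hv z.2 _⟩)
  have hclose := hQlim.eventually (Metric.closedBall_mem_nhds _ (half_pos hε))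
  obtain ⟨A, hA, B, hB, hAB⟩ := eventually_prod_iff.1 hclose
  obtain ⟨r, hr, hrA⟩ := Metric.eventually_nhds_iff.1 hA
  refine ⟨r / 2, half_pos hr, ?_⟩
  filter_upwards [hB, hpQ (ε / 2) (half_pos hε), hlim.eventually (gt_mem_nhds (half_pos hr))]
    with a hBa hcons hha s hs
  refine abs_sub_floor_sub_le (P := fun m => p (v a m)) (hh a) hε.le s.2 t.2 fun m hm => ?_
  obtain ⟨τ, hτ⟩ : ∃ τ : ℝ≥0, (τ : ℝ) = m * h a := ⟨⟨m * h a, by have := hh a; positivity⟩, rfl⟩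
  have hτt : dist τ t < r := by
    rw [NNReal.dist_eq, abs_lt] at hs ⊢
    have hmin : (t : ℝ) - r / 2 < min (s : ℝ) t := lt_min (by linarith) (by linarith)
    have hmax : max (s : ℝ) t < t + r / 2 := max_lt (by linarith) (by linarith)
    exact ⟨by linarith [hm.1], by linarith [hm.2]⟩
  have hτv : stepCurve h v τ a = v a m := by
    rw [stepCurve, hτ, mul_div_cancel_right₀ _ (hh a).ne', Nat.floor_natCast]
  have hQm : |Q (v a m) - Q x| ≤ ε / 2 := by
    simpa [hτv, Real.dist_eq] using hAB (hrA hτt) hBa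
  calc |p (v a (m + 1)) - p (v a m) - h a * Q x|
      = |(p (v a (m + 1)) - p (v a m) - h a * Q (v a m)) + h a * (Q (v a m) - Q x)| := by
        ring_nf
    _ ≤ ε / 2 * h a + h a * (ε / 2) := by
        refine (abs_add_le _ _).trans (add_le_add (hcons m) ?_)
        rw [abs_mul, abs_of_pos (hh a)]
        exact mul_le_mul_of_nonneg_left hQm (hh a).le
    _ = ε * h a := by ring

theorem IsConsistent.hasDerivAt [NeBot l] (hpQ : IsConsistent l h v p Q)
    (hp : Continuous p) (hQ : ContinuousOn Q K) (hv : ∀ a k, v a k ∈ K) (hh : ∀ a, 0 < h a)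
    (hlim : Tendsto h l (𝓝 0)) {u : ℝ≥0 → X} (huK : ∀ t, u t ∈ K)
    (hu : ∀ t, Tendsto (fun z : ℝ≥0 × α => stepCurve h v z.1 z.2) (𝓝 t ×ˢ l) (𝓝 (u t)))
    {t : ℝ} (ht : 0 < t) :
    HasDerivAt (fun s : ℝ => p (u s.toNNReal)) (Q (u t.toNNReal)) t := by
  have hconv (s : ℝ≥0) : Tendsto (fun a => p (stepCurve h v s a)) l (𝓝 (p (u s))) :=
    (hp.tendsto (u s)).comp (tendsto_of_tendsto_nhds_prod (hu s))
  refine hasDerivAt_iff_isLittleO.2 (isLittleO_iff.2 fun ε hε => ?_)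
  obtain ⟨r, hr, hstep⟩ := hpQ.exists_abs_stepCurve_sub_le hQ hv hh hlim (huK _) (hu t.toNNReal) hε
  filter_upwards [continuous_real_toNNReal.continuousAt (Metric.ball_mem_nhds _ hr),
    lt_mem_nhds ht] with s hs hs₀
  have hle := le_of_tendsto_of_tendsto
    (((hconv s.toNNReal).sub (hconv t.toNNReal)).sub_const _).abs
    ((hlim.const_mul _).const_add _) (hstep.mono fun a ha => ha s.toNNReal hs)
  simpa [Real.coe_toNNReal, ht.le, hs₀.le, mul_comm ε] using hle

theorem exists_limit_curve_of_isConsistent {ι : Type*} [NeBot l] {p Q : ι → X → ℝ}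
    (hK : IsCompact K) (hp : ∀ i, Continuous (p i)) (hinj : InjOn (fun x i => p i x) K)
    (hQ : ∀ i, ContinuousOn (Q i) K) (hv : ∀ a k, v a k ∈ K) (hh : ∀ a, 0 < h a)
    (hlim : Tendsto h l (𝓝 0)) (hpQ : ∀ i, IsConsistent l h v (p i) (Q i))
    {x₀ : X} (hx₀ : ∀ a, v a 0 = x₀) :
    ∃ u : ℝ≥0 → X, Continuous u ∧ u 0 = x₀ ∧ (∀ t, u t ∈ K) ∧
      ∀ i, ∀ t > 0, HasDerivAt (fun s : ℝ => p i (u s.toNNReal)) (Q i (u t.toNNReal)) t := by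
  let U := Ultrafilter.of l
  have hU : (U : Filter α) ≤ l := Ultrafilter.of_le l
  have hpU (i : ι) : IsConsistent U h v (p i) (Q i) := fun ε hε => hU (hpQ i ε hε)
  obtain ⟨u, hu, huK, hlimu⟩ := exists_continuous_ultrafilter_limit (w := stepCurve h v) hK hp hinj
    (fun t a => hv a _) fun i t =>
      (hpU i).tendsto_stepCurve_sub hK (hQ i) hv hh (hlim.mono_left hU) t
  refine ⟨u, hu, hinj (huK 0) ?_ (funext fun i => ?_), huK, fun i t ht =>
    (hpU i).hasDerivAt (hp i) (hQ i) hv hh (hlim.mono_left hU) huK hlimu ht⟩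
  · obtain ⟨a⟩ : Nonempty α := nonempty_of_neBot l
    exact hx₀ a ▸ hv a 0
  · have hlim₀ := ((hp i).tendsto (u 0)).comp (tendsto_of_tendsto_nhds_prod (hlimu 0))
    exact tendsto_nhds_unique hlim₀ (tendsto_const_nhds.congr fun a => by simp [stepCurve, hx₀])

end OneStepSchemes

section WeightedConvergence

variable {Y α : Type*} [TopologicalSpace Y] {l : Filter α} {F : α → Y →ᵇ ℝ} {G W : Y → ℝ}

/-- Uniform convergence relative to the weight `W`, i.e. in the norm `sup |·| / W`. -/
def TendstoWeighted (F : α → Y →ᵇ ℝ) (G : Y → ℝ) (l : Filter α) (W : Y → ℝ) : Prop :=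
  ∀ ε > 0, ∀ᶠ a in l, ∀ y, |F a y - G y| ≤ ε * W y

theorem TendstoWeighted.tendsto_apply (h : TendstoWeighted F G l W) (y : Y) :
    Tendsto (fun a => F a y) l (𝓝 (G y)) := by
  refine Metric.tendsto_nhds.2 fun ε hε => ?_
  have hW : 0 < |W y| + 1 := by positivity
  filter_upwards [h (ε / (|W y| + 1)) (by positivity)] with a ha
  calc dist (F a y) (G y) ≤ ε / (|W y| + 1) * W y := ha y
    _ ≤ ε / (|W y| + 1) * |W y| := by gcongr; exact le_abs_self _
    _ < ε / (|W y| + 1) * (|W y| + 1) := by gcongr; linarith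
    _ = ε := div_mul_cancel₀ _ hW.ne'

variable [MeasurableSpace Y] [OpensMeasurableSpace Y] [NeBot l] [l.IsCountablyGenerated]

theorem TendstoWeighted.integrable (h : TendstoWeighted F G l W) {ν : Measure Y} [IsFiniteMeasure ν]
    (hW : Integrable W ν) : Integrable G ν := by
  obtain ⟨a, ha⟩ := (h 1 one_pos).exists
  refine ((integrable_const ‖F a‖).add hW).mono' ?_ (ae_of_all _ fun y => ?_)
  · exact aestronglyMeasurable_of_tendsto_ae l
      (fun a => (F a).continuous.measurable.aestronglyMeasurable)
      (ae_of_all _ h.tendsto_apply)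
  · have hFa := (F a).norm_coe_le_norm y
    have htri := norm_le_norm_add_norm_sub (F a y) (G y)
    have hdist := ha y
    rw [one_mul, ← Real.norm_eq_abs] at hdist
    simpa using (htri.trans (add_le_add hFa hdist))

theorem TendstoWeighted.tendstoUniformlyOn_integral (h : TendstoWeighted F G l W) {T : Type*}
    {ν : T → Measure Y} [∀ t, IsFiniteMeasure (ν t)] {s : Set T} {D : ℝ}
    (hW : ∀ t ∈ s, Integrable W (ν t)) (hD : ∀ t ∈ s, ∫ y, W y ∂ν t ≤ D) :
    TendstoUniformlyOn (fun a t => ∫ y, F a y ∂ν t) (fun t => ∫ y, G y ∂ν t) l s := by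
  refine Metric.tendstoUniformlyOn_iff.2 fun ε hε => ?_
  filter_upwards [h (ε / (|D| + 1)) (by positivity)] with a ha t ht
  calc dist (∫ y, G y ∂ν t) (∫ y, F a y ∂ν t) = ‖∫ y, (F a y - G y) ∂ν t‖ := by
        rw [integral_sub ((F a).integrable _) (h.integrable (hW t ht)), dist_comm, dist_eq_norm]
    _ ≤ ∫ y, ε / (|D| + 1) * W y ∂ν t :=
        norm_integral_le_of_norm_le ((hW t ht).const_mul _) (ae_of_all _ ha)
    _ ≤ ε / (|D| + 1) * |D| := by
        rw [integral_const_mul]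
        gcongr
        exact (hD t ht).trans (le_abs_self D)
    _ < ε / (|D| + 1) * (|D| + 1) := by gcongr; linarith
    _ = ε := div_mul_cancel₀ _ (by positivity)

end WeightedConvergence

section Moments

variable {S : Type*} [TopologicalSpace S]

/-- The truncation `min W N` of a continuous weight. -/
def truncAt (W : C(S, ℝ≥0)) (N : ℕ) : S →ᵇ ℝ≥0 :=
  .mkOfBound (W ⊓ .const S N) N fun x y => by
    have h (z : S) : ((W ⊓ .const S (N : ℝ≥0) : C(S, ℝ≥0)) z : ℝ) ∈ Icc (0 : ℝ) N :=
      ⟨NNReal.coe_nonneg _, NNReal.coe_le_coe.2 (min_le_right (W z) (N : ℝ≥0))⟩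
    simpa only [NNReal.dist_eq, Real.dist_eq, sub_zero] using Real.dist_le_of_mem_Icc (h x) (h y)

theorem truncAt_apply (W : C(S, ℝ≥0)) (N : ℕ) (x : S) : truncAt W N x = min (W x) N := rfl

variable [MeasurableSpace S]

/-- The finite measures of mass `M` whose `W`-moment is at most `c`. -/
def momentSet (W : C(S, ℝ≥0)) (M c : ℝ≥0) : Set (FiniteMeasure S) :=
  {μ | μ.mass = M ∧ ∫⁻ x, W x ∂(μ : Measure S) ≤ c}

variable [OpensMeasurableSpace S] {W : C(S, ℝ≥0)}

theorem lintegral_eq_iSup_truncAt (W : C(S, ℝ≥0)) (μ : Measure S) :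
    ∫⁻ x, W x ∂μ = ⨆ N, ∫⁻ x, truncAt W N x ∂μ := by
  rw [← lintegral_iSup (fun N => (truncAt W N).continuous.measurable.coe_nnreal_ennreal)]
  · congr 1 with x
    refine le_antisymm ?_ (iSup_le fun N => ENNReal.coe_le_coe.2 (min_le_left _ _))
    obtain ⟨N, hN⟩ := exists_nat_ge (W x)
    exact le_iSup_of_le N (by rw [truncAt_apply, min_eq_left hN])
  · exact fun N N' hN x => ENNReal.coe_le_coe.2 (min_le_min_left (W x) (Nat.cast_le.2 hN))

theorem isClosed_lintegral_le (W : C(S, ℝ≥0)) (c : ℝ≥0∞) :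
    IsClosed {μ : FiniteMeasure S | ∫⁻ x, W x ∂(μ : Measure S) ≤ c} := by
  simp_rw [lintegral_eq_iSup_truncAt W, iSup_le_iff, ofPred_forall]
  refine isClosed_iInter fun N => isClosed_le ?_ continuous_const
  have htest := FiniteMeasure.continuous_testAgainstNN_eval (truncAt W N)
  exact (ENNReal.continuous_coe.comp htest).congr fun μ => FiniteMeasure.testAgainstNN_coe_eq

theorem isCompact_momentSet [T2Space S] [BorelSpace S]
    (hW : ∀ N : ℕ, IsCompact {x | W x ≤ N}) (M c : ℝ≥0) : IsCompact (momentSet W M c) := by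
  have hlim : Tendsto (fun n : ℕ => c / (n + 1 : ℕ)) atTop (𝓝 0) :=
    (tendsto_const_div_atTop_nhds_zero_nat c).comp (tendsto_add_atTop_nat 1)
  have htight := isCompact_setOfPred_finiteMeasure_mass_eq_compl_isCompact_le M hlim
    (fun n => hW (n + 1)) <| .inr fun n m hnm x (hx : W x ≤ _) =>
      hx.trans (Nat.cast_le.2 (Nat.succ_le_succ hnm))
  refine htight.of_isClosed_subset ((isClosed_eq (by fun_prop) continuous_const).inter
    (isClosed_lintegral_le W c)) ?_
  rintro μ ⟨hμ, hμc⟩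
  refine ⟨hμ, fun n => ?_⟩
  rw [← ENNReal.coe_le_coe, FiniteMeasure.ennreal_coeFn_eq_coeFn_toMeasure]
  calc (μ : Measure S) {x | W x ≤ (n + 1 : ℕ)}ᶜ
      ≤ (μ : Measure S) {x | ((n + 1 : ℕ) : ℝ≥0∞) ≤ W x} :=
        measure_mono fun x (hx : ¬ W x ≤ _) => by
          simpa using ENNReal.coe_le_coe.2 (not_le.1 hx).le
    _ ≤ (∫⁻ x, W x ∂(μ : Measure S)) / (n + 1 : ℕ) :=
        meas_ge_le_lintegral_div W.continuous.measurable.coe_nnreal_ennreal.aemeasurable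
          (by simp) (by simp)
    _ ≤ c / (n + 1 : ℕ) := ENNReal.div_le_div_right hμc _
    _ = (c / (n + 1 : ℕ) : ℝ≥0) := by rw [ENNReal.coe_div (by positivity), ENNReal.coe_natCast]

theorem integrable_coe_of_lintegral_ne_top {μ : Measure S} (h : ∫⁻ x, W x ∂μ ≠ ⊤) :
    Integrable (fun x => (W x : ℝ)) μ := by
  refine ⟨(NNReal.continuous_coe.comp W.continuous).measurable.aestronglyMeasurable, ?_⟩
  simpa [HasFiniteIntegral] using h.lt_top

theorem integrable_fst_add_snd {μ : Measure S} [IsFiniteMeasure μ] (h : ∫⁻ x, W x ∂μ ≠ ⊤) :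
    Integrable (fun p : S × S => (W p.1 + W p.2 : ℝ)) (μ.prod μ) :=
  ((integrable_coe_of_lintegral_ne_top h).comp_fst μ).add
    ((integrable_coe_of_lintegral_ne_top h).comp_snd μ)

theorem integral_fst_add_snd_le {M c : ℝ≥0} {μ : FiniteMeasure S} (hμ : μ ∈ momentSet W M c) :
    ∫ p : S × S, (W p.1 + W p.2 : ℝ) ∂(μ : Measure S).prod (μ : Measure S) ≤ 2 * (M * c) := by
  obtain ⟨hM, hc⟩ := hμ
  have hint := integrable_coe_of_lintegral_ne_top (hc.trans_lt ENNReal.coe_lt_top).ne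
  have hmass : (μ : Measure S).real univ = M := by rw [← hM]; rfl
  have hle : ∫ x, (W x : ℝ) ∂(μ : Measure S) ≤ c := by
    rwa [lintegral_coe_eq_integral _ hint, ENNReal.ofReal_le_iff_le_toReal ENNReal.coe_ne_top]
      at hc
  calc ∫ p : S × S, (W p.1 + W p.2 : ℝ) ∂(μ : Measure S).prod (μ : Measure S)
      = 2 * (M * ∫ x, (W x : ℝ) ∂(μ : Measure S)) := by
        rw [integral_add (hint.comp_fst _) (hint.comp_snd _), integral_fun_fst (fun x => (W x : ℝ)),
          integral_fun_snd (fun x => (W x : ℝ)), hmass, smul_eq_mul]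
        ring
    _ ≤ 2 * (M * c) := by gcongr

end Moments

section Products

variable {S T : Type*} [MeasurableSpace S] [MeasurableSpace T] [Nonempty S] [Nonempty T]

theorem finiteMeasure_prod_eq_mass_smul_normalize (μ : FiniteMeasure S) (ν : FiniteMeasure T) :
    μ.prod ν = (μ.mass * ν.mass) • (μ.normalize.prod ν.normalize).toFiniteMeasure := by
  refine Subtype.ext ?_
  have hμ := congrArg FiniteMeasure.toMeasure μ.self_eq_mass_smul_normalize
  have hν := congrArg FiniteMeasure.toMeasure ν.self_eq_mass_smul_normalize
  calc (μ : Measure S).prod (ν : Measure T)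
      = (μ.mass • μ.normalize.toFiniteMeasure : FiniteMeasure S).toMeasure.prod
          (ν.mass • ν.normalize.toFiniteMeasure : FiniteMeasure T).toMeasure := by rw [← hμ, ← hν]
    _ = _ := by
      simp [FiniteMeasure.toMeasure_smul, Measure.prod_smul_left, Measure.prod_smul_right,
        smul_smul, mul_comm]

variable [TopologicalSpace S] [TopologicalSpace T] [SecondCountableTopology S]
  [SecondCountableTopology T] [TopologicalSpace.PseudoMetrizableSpace S]
  [TopologicalSpace.PseudoMetrizableSpace T] [OpensMeasurableSpace S] [OpensMeasurableSpace T]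

theorem continuous_finiteMeasure_prod :
    Continuous fun μ : FiniteMeasure S × FiniteMeasure T => μ.1.prod μ.2 := by
  refine continuous_iff_continuousAt.2 fun ⟨μ, ν⟩ => ?_
  have hmass : Tendsto (fun z : FiniteMeasure S × FiniteMeasure T => z.1.mass * z.2.mass)
      (𝓝 (μ, ν)) (𝓝 (μ.mass * ν.mass)) := Continuous.tendsto (by fun_prop) _
  by_cases hzero : μ = 0 ∨ ν = 0
  · have hprod : μ.prod ν = 0 := by rcases hzero with rfl | rfl <;> simp
    rw [ContinuousAt, hprod]
    refine FiniteMeasure.tendsto_zero_of_tendsto_zero_mass ?_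
    simpa [← FiniteMeasure.mass_prod, hprod] using hmass
  · obtain ⟨hμ, hν⟩ := not_or.1 hzero
    have hnormalize : Tendsto (fun z : FiniteMeasure S × FiniteMeasure T =>
        (z.1.normalize, z.2.normalize)) (𝓝 (μ, ν)) (𝓝 (μ.normalize, ν.normalize)) :=
      (FiniteMeasure.tendsto_normalize_of_tendsto continuous_fst.continuousAt hμ).prodMk_nhds
        (FiniteMeasure.tendsto_normalize_of_tendsto continuous_snd.continuousAt hν)
    have hprod := ((ProbabilityMeasure.toFiniteMeasure_continuous.comp
      ProbabilityMeasure.continuous_prod).tendsto (μ.normalize, ν.normalize)).comp hnormalize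
    simp only [ContinuousAt, finiteMeasure_prod_eq_mass_smul_normalize]
    exact hmass.smul hprod

end Products

section QuadraticForms

variable {S : Type*} [MeasurableSpace S]

/-- The quadratic form `½ ∬ F(x, y) μ(dx) μ(dy)` of a function of two variables. -/
def quadForm (F : S × S → ℝ) (μ : FiniteMeasure S) : ℝ :=
  (1 / 2) * ∫ p, F p ∂(μ : Measure S).prod (μ : Measure S)

variable [TopologicalSpace S] [OpensMeasurableSpace S] [SecondCountableTopology S]

theorem continuous_quadForm [TopologicalSpace.PseudoMetrizableSpace S] [Nonempty S]
    (F : S × S →ᵇ ℝ) : Continuous (quadForm F) := by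
  have hprod : Continuous fun μ : FiniteMeasure S => μ.prod μ :=
    continuous_finiteMeasure_prod.comp (continuous_id.prodMk continuous_id)
  exact ((FiniteMeasure.continuous_integral_boundedContinuousFunction F).comp hprod).const_mul _

variable {α : Type*} {l : Filter α} [NeBot l] [l.IsCountablyGenerated] {F : α → S × S →ᵇ ℝ}
  {G : S × S → ℝ} {W : C(S, ℝ≥0)}

theorem TendstoWeighted.tendstoUniformlyOn_quadForm
    (h : TendstoWeighted F G l fun p => W p.1 + W p.2) (M c : ℝ≥0) :
    TendstoUniformlyOn (fun a => quadForm (F a)) (quadForm G) l (momentSet W M c) :=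
  (uniformContinuous_const_smul (1 / 2 : ℝ)).comp_tendstoUniformlyOn <|
    h.tendstoUniformlyOn_integral (D := 2 * (M * c))
      (ν := fun μ : FiniteMeasure S => (μ : Measure S).prod (μ : Measure S))
      (fun _ hμ => integrable_fst_add_snd (hμ.2.trans_lt ENNReal.coe_lt_top).ne)
      fun _ hμ => integral_fst_add_snd_le hμ

theorem TendstoWeighted.continuousOn_quadForm [TopologicalSpace.PseudoMetrizableSpace S]
    [Nonempty S] (h : TendstoWeighted F G l fun p => W p.1 + W p.2) (M c : ℝ≥0) :
    ContinuousOn (quadForm G) (momentSet W M c) :=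
  (h.tendstoUniformlyOn_quadForm M c).continuousOn
    (Frequently.of_forall fun a => (continuous_quadForm (F a)).continuousOn)

end QuadraticForms

section EulerStep

variable {S : Type*} [TopologicalSpace S]

/-- The bounded integrand `r(x, y) (f(x) - f(y))` of the weak form of the evolution with exchange
rate `r`. -/
def collision (r : S × S →ᵇ ℝ) (f : S →ᵇ ℝ) : S × S →ᵇ ℝ :=
  r * (f.compContinuous .fst - f.compContinuous .snd)

theorem collision_apply (r : S × S →ᵇ ℝ) (f : S →ᵇ ℝ) (p : S × S) :
    collision r f p = r p * (f p.1 - f p.2) := rfl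

variable [MeasurableSpace S] {r : S × S →ᵇ ℝ} {μ : FiniteMeasure S}

/-- The density `1 + ∫ r(x, y) μ(dy)` with respect to `μ` of an explicit Euler step; the time step
is absorbed into the rate `r`. -/
def eulerDensity (r : S × S →ᵇ ℝ) (μ : Measure S) (x : S) : ℝ :=
  1 + ∫ y, r (x, y) ∂μ

theorem abs_integral_rate_le (r : S × S →ᵇ ℝ) (μ : Measure S) [IsFiniteMeasure μ] (x : S) :
    |∫ y, r (x, y) ∂μ| ≤ ‖r‖ * μ.real univ :=
  norm_integral_le_of_norm_le_const (ae_of_all _ fun y => r.norm_coe_le_norm (x, y))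

theorem eulerDensity_nonneg {μ : Measure S} [IsFiniteMeasure μ] (hr : ‖r‖ * μ.real univ ≤ 1)
    (x : S) : 0 ≤ eulerDensity r μ x := by
  have := (abs_le.1 (abs_integral_rate_le r μ x)).1
  unfold eulerDensity
  linarith

theorem quadForm_collision_nonpos (hanti : ∀ x y, r (y, x) = -r (x, y)) {f : S →ᵇ ℝ}
    (hf : ∀ x y, f x < f y → 0 ≤ r (x, y)) : quadForm (collision r f) μ ≤ 0 := by
  refine mul_nonpos_of_nonneg_of_nonpos (by norm_num) (integral_nonpos fun ⟨x, y⟩ => ?_)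
  rw [collision_apply]
  rcases lt_trichotomy (f x) (f y) with h | h | h
  · exact mul_nonpos_of_nonneg_of_nonpos (hf x y h) (sub_nonpos.2 h.le)
  · simp [h]
  · have hyx := hf y x h
    rw [hanti] at hyx
    exact mul_nonpos_of_nonpos_of_nonneg (neg_nonneg.1 hyx) (sub_nonneg.2 h.le)

variable [OpensMeasurableSpace S] [SecondCountableTopology S]

theorem measurable_eulerDensity (r : S × S →ᵇ ℝ) (μ : Measure S) [SFinite μ] :
    Measurable (eulerDensity r μ) :=
  r.continuous.measurable.stronglyMeasurable.integral_prod_right'.measurable.const_add 1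

theorem integrable_eulerDensity (r : S × S →ᵇ ℝ) (μ : Measure S) [IsFiniteMeasure μ] :
    Integrable (eulerDensity r μ) μ :=
  .of_bound (measurable_eulerDensity r μ).aestronglyMeasurable (1 + ‖r‖ * μ.real univ) <|
    ae_of_all _ fun x => (abs_add_le _ _).trans <| by
      rw [abs_one]
      gcongr
      exact abs_integral_rate_le r μ x

/-- The explicit Euler step `μ ↦ (1 + ∫ r(·, y) μ(dy)) μ`. Its density is cut off at `0`, which
is harmless as soon as `‖r‖ μ(S) ≤ 1`. -/
def eulerStep (r : S × S →ᵇ ℝ) (μ : FiniteMeasure S) : FiniteMeasure S :=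
  ⟨(μ : Measure S).withDensity fun x => ENNReal.ofReal (eulerDensity r μ x),
    isFiniteMeasure_withDensity_ofReal (integrable_eulerDensity r μ).2⟩

theorem integral_eulerStep_eq_integral_mul (hr : ‖r‖ * μ.mass ≤ 1) (f : S → ℝ) :
    ∫ x, f x ∂(eulerStep r μ : Measure S) = ∫ x, eulerDensity r μ x * f x ∂(μ : Measure S) := by
  change ∫ x, f x ∂(μ : Measure S).withDensity _ = _
  rw [integral_withDensity_eq_integral_toReal_smul
    (measurable_eulerDensity r μ).ennreal_ofReal (ae_of_all _ fun _ => ENNReal.ofReal_lt_top)]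
  refine integral_congr_ae (ae_of_all _ fun x => ?_)
  simp only [ENNReal.toReal_ofReal (eulerDensity_nonneg hr x), smul_eq_mul]

theorem quadForm_collision (hanti : ∀ x y, r (y, x) = -r (x, y)) (f : S →ᵇ ℝ) :
    quadForm (collision r f) μ = ∫ x, (∫ y, r (x, y) ∂(μ : Measure S)) * f x ∂(μ : Measure S) := by
  let rf₁ : S × S →ᵇ ℝ := r * f.compContinuous .fst
  let rf₂ : S × S →ᵇ ℝ := r * f.compContinuous .snd
  have hswap : ∫ p, rf₂ p ∂(μ : Measure S).prod μ = -∫ p, rf₁ p ∂(μ : Measure S).prod μ := by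
    rw [← integral_prod_swap, ← integral_neg]
    refine integral_congr_ae (ae_of_all _ fun p => ?_)
    change r (p.2, p.1) * f p.1 = -(r (p.1, p.2) * f p.1)
    rw [hanti, neg_mul]
  calc quadForm (collision r f) μ
      = (1 / 2) * ∫ p, (rf₁ p - rf₂ p) ∂(μ : Measure S).prod μ := by
        simp only [quadForm, collision_apply, mul_sub]
        rfl
    _ = ∫ p, rf₁ p ∂(μ : Measure S).prod μ := by
        rw [integral_sub (rf₁.integrable _) (rf₂.integrable _), hswap]
        ring
    _ = ∫ x, (∫ y, r (x, y) ∂(μ : Measure S)) * f x ∂(μ : Measure S) := by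
        rw [integral_prod _ (rf₁.integrable _)]
        simp_rw [← integral_mul_const]
        rfl

theorem integral_eulerStep (hanti : ∀ x y, r (y, x) = -r (x, y)) (hr : ‖r‖ * μ.mass ≤ 1)
    (f : S →ᵇ ℝ) :
    ∫ x, f x ∂(eulerStep r μ : Measure S) =
      ∫ x, f x ∂(μ : Measure S) + quadForm (collision r f) μ := by
  have hint : Integrable (fun x => eulerDensity r μ x * f x) (μ : Measure S) :=
    (integrable_eulerDensity r μ).mul_bdd f.continuous.measurable.aestronglyMeasurable
      (ae_of_all _ f.norm_coe_le_norm)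
  rw [integral_eulerStep_eq_integral_mul hr, quadForm_collision hanti, ← sub_eq_iff_eq_add',
    ← integral_sub hint (f.integrable _)]
  refine integral_congr_ae (ae_of_all _ fun x => ?_)
  simp only [eulerDensity]
  ring

theorem mass_eulerStep (hanti : ∀ x y, r (y, x) = -r (x, y)) (hr : ‖r‖ * μ.mass ≤ 1) :
    (eulerStep r μ).mass = μ.mass := by
  have hone := integral_eulerStep hanti hr (.const S 1)
  have hzero : collision r (.const S 1) = 0 := by ext; simp [collision_apply]
  have huniv : (eulerStep r μ : Measure S).real univ = (μ : Measure S).real univ := by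
    simpa [quadForm, hzero] using hone
  exact NNReal.coe_injective huniv

theorem lintegral_eulerStep_le (hanti : ∀ x y, r (y, x) = -r (x, y)) (hr : ‖r‖ * μ.mass ≤ 1)
    {W : C(S, ℝ≥0)} (hW : ∀ x y, W x < W y → 0 ≤ r (x, y)) :
    ∫⁻ x, W x ∂(eulerStep r μ : Measure S) ≤ ∫⁻ x, W x ∂(μ : Measure S) := by
  simp only [lintegral_eq_iSup_truncAt W]
  refine iSup_mono fun N => ?_
  let f : S →ᵇ ℝ := (truncAt W N).comp ((↑) : ℝ≥0 → ℝ) NNReal.isometry_coe.lipschitz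
  have hf : ∀ x y, f x < f y → 0 ≤ r (x, y) := fun x y hxy =>
    hW x y (lt_of_not_ge fun h => hxy.not_ge (NNReal.coe_le_coe.2 (min_le_min_right _ h)))
  rw [← ENNReal.toReal_le_toReal ((truncAt W N).lintegral_lt_top_of_nnreal _).ne
    ((truncAt W N).lintegral_lt_top_of_nnreal _).ne]
  simp only [BoundedContinuousFunction.toReal_lintegral_coe_eq_integral]
  exact (integral_eulerStep hanti hr f).trans_le
    (add_le_of_nonpos_right (quadForm_collision_nonpos hanti hf))

theorem eulerStep_mem_momentSet (hanti : ∀ x y, r (y, x) = -r (x, y)) {W : C(S, ℝ≥0)}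
    (hW : ∀ x y, W x < W y → 0 ≤ r (x, y)) {M c : ℝ≥0} (hr : ‖r‖ * M ≤ 1)
    (hμ : μ ∈ momentSet W M c) : eulerStep r μ ∈ momentSet W M c := by
  obtain ⟨rfl, hc⟩ := hμ
  exact ⟨mass_eulerStep hanti hr, (lintegral_eulerStep_le hanti hr hW).trans hc⟩

end EulerStep

section TestFunctions

/-- The test functions of the weak formulation: `φ ∈ C¹_b([0, ∞))` with `φ'(0) = 0`. -/
structure IsTestFunction (φ : ℝ → ℝ) : Prop extends IsC1b φ where
  derivWithin_zero : derivWithin φ (Ici 0) 0 = 0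

variable {φ : ℝ → ℝ}

theorem IsC1b.continuous_coe (hφ : IsC1b φ) : Continuous fun x : ℝ≥0 => φ x :=
  hφ.contDiffOn.continuousOn.comp_continuous NNReal.continuous_coe fun x => x.2

/-- The restriction of `φ ∈ C¹_b([0, ∞))` to `ℝ≥0`, as a bounded continuous function. -/
def IsC1b.restrict (hφ : IsC1b φ) : ℝ≥0 →ᵇ ℝ :=
  .ofNormedAddCommGroup (fun x => φ x) hφ.continuous_coe hφ.bounded.choose
    fun x => hφ.bounded.choose_spec x x.2

theorem eventually_coe_le_nhds_zero {r : ℝ} (hr : 0 < r) :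
    ∀ᶠ p : ℝ≥0 × ℝ≥0 in 𝓝 0, (p.1 : ℝ) ≤ r ∧ (p.2 : ℝ) ≤ r := by
  filter_upwards [Metric.closedBall_mem_nhds 0 hr] with p hp
  simpa [Prod.dist_eq, NNReal.dist_eq] using hp

theorem IsTestFunction.isLittleO_sub (hφ : IsTestFunction φ) :
    (fun p : ℝ≥0 × ℝ≥0 => φ p.1 - φ p.2) =o[𝓝 0] fun p => (p.1 : ℝ) - p.2 := by
  have hcont := hφ.contDiffOn.continuousOn_derivWithin (uniqueDiffOn_Ici 0) le_rfl 0 self_mem_Ici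
  rw [ContinuousWithinAt, hφ.derivWithin_zero] at hcont
  refine isLittleO_iff.2 fun ε hε => ?_
  obtain ⟨r, hr, hsub⟩ := nhdsGE_basis_Icc.mem_iff.1
    (hcont.eventually (Metric.closedBall_mem_nhds 0 hε))
  filter_upwards [eventually_coe_le_nhds_zero hr] with p ⟨hp₁, hp₂⟩
  refine (convex_Icc 0 r).norm_image_sub_le_of_norm_hasDerivWithin_le (fun z hz => ?_)
    (fun z hz => mem_closedBall_zero_iff.1 (hsub hz)) ⟨p.2.coe_nonneg, hp₂⟩ ⟨p.1.coe_nonneg, hp₁⟩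
  exact (hφ.contDiffOn.differentiableOn one_ne_zero z hz.1).hasDerivWithinAt.mono
    Icc_subset_Ici_self

theorem isTestFunction_contDiffBump (f : ContDiffBump (0 : ℝ)) : IsTestFunction f := by
  have hderiv : ∀ x ∈ Ici (0 : ℝ), derivWithin f (Ici 0) x = deriv f x := fun x hx =>
    (f.contDiff.differentiable one_ne_zero x).derivWithin (uniqueDiffOn_Ici 0 x hx)
  refine ⟨⟨f.contDiff.contDiffOn, ⟨1, fun x _ => ?_⟩, ?_⟩, ?_⟩
  · exact abs_le.2 ⟨by linarith [f.nonneg' x], f.le_one⟩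
  · obtain ⟨M, hM⟩ := (f.contDiff.continuous_deriv le_rfl).bounded_above_of_compact_support
      f.hasCompactSupport.deriv
    exact ⟨M, fun x hx => (congrArg _ (hderiv x hx)).trans_le (hM x)⟩
  · rw [hderiv 0 self_mem_Ici, f.eventuallyEq_one.deriv_eq]
    exact deriv_const 0 1

/-- A smooth approximation from above of the indicator function of `[0, a]`. -/
def cutoffBump (a : ℝ≥0) (m : ℕ) : ContDiffBump (0 : ℝ) where
  rIn := a + 1 / ((m + 1 : ℕ) + 1)
  rOut := a + 1 / (m + 1)
  rIn_pos := by positivity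
  rIn_lt_rOut := by gcongr; simp

theorem tendsto_cutoffBump (a x : ℝ≥0) :
    Tendsto (fun m => cutoffBump a m x) atTop (𝓝 ((Iic a).indicator 1 x)) := by
  rcases le_or_gt x a with hxa | hxa
  · rw [indicator_of_mem (mem_Iic.2 hxa)]
    refine tendsto_const_nhds.congr fun m => (ContDiffBump.one_of_mem_closedBall _ ?_).symm
    rw [mem_closedBall_zero_iff, Real.norm_of_nonneg x.coe_nonneg]
    exact le_add_of_le_of_nonneg (NNReal.coe_le_coe.2 hxa) (by positivity)
  · rw [indicator_of_notMem (by simpa using hxa)]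
    have hlim : Tendsto (fun m => (cutoffBump a m).rOut) atTop (𝓝 a) := by
      simpa only [cutoffBump, add_zero] using
        (tendsto_one_div_add_atTop_nhds_zero_nat (𝕜 := ℝ)).const_add (a : ℝ)
    refine tendsto_const_nhds.congr' ?_
    filter_upwards [hlim.eventually_le_const (NNReal.coe_lt_coe.2 hxa)] with m hm
    rw [ContDiffBump.zero_of_le_dist]
    rwa [dist_zero_right, Real.norm_of_nonneg x.coe_nonneg]

theorem finiteMeasure_ext_of_integral_isTestFunction {μ ν : FiniteMeasure ℝ≥0}
    (h : ∀ φ : ℝ → ℝ, IsTestFunction φ →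
      ∫ x : ℝ≥0, φ x ∂(μ : Measure ℝ≥0) = ∫ x : ℝ≥0, φ x ∂(ν : Measure ℝ≥0)) : μ = ν := by
  have hlim (κ : FiniteMeasure ℝ≥0) (a : ℝ≥0) : Tendsto
      (fun m => ∫ x : ℝ≥0, cutoffBump a m x ∂(κ : Measure ℝ≥0)) atTop
      (𝓝 ((κ : Measure ℝ≥0).real (Iic a))) := by
    rw [← integral_indicator_one measurableSet_Iic]
    refine tendsto_integral_of_dominated_convergence 1
      (fun m => ((cutoffBump a m).continuous.comp NNReal.continuous_coe).aestronglyMeasurable)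
      (integrable_const 1) (fun m => ae_of_all _ fun x => ?_)
      (ae_of_all _ fun x => tendsto_cutoffBump a x)
    exact (Real.norm_of_nonneg (ContDiffBump.nonneg' _ _)).trans_le (ContDiffBump.le_one _)
  refine Subtype.ext (Measure.ext_of_Iic (μ : Measure ℝ≥0) ν fun a => ?_)
  refine (measureReal_eq_measureReal_iff).1 ?_
  exact tendsto_nhds_unique (hlim μ a) <|
    (hlim ν a).congr fun m => (h _ (isTestFunction_contDiffBump _)).symm

end TestFunctions

section Kernel

variable {B : ℝ≥0 → ℝ≥0 → ℝ} {θ δ ρ C : ℝ}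

theorem eq_zero_of_zero_left_mem_gammaRegion {y : ℝ≥0} (h : (0, y) ∈ gammaRegion θ δ ρ) :
    y = 0 := by
  have hy : (y : ℝ) ≤ 0 := by rcases h with ⟨-, -, h⟩ | ⟨-, h⟩ <;> simpa using h
  exact NNReal.coe_eq_zero.1 (hy.antisymm y.coe_nonneg)

theorem eq_zero_of_zero_right_mem_gammaRegion {x : ℝ≥0} (hθ : 0 < θ)
    (h : (x, 0) ∈ gammaRegion θ δ ρ) : x = 0 := by
  have hx : (x : ℝ) ≤ 0 := by
    rcases h with ⟨-, h, -⟩ | ⟨-, h⟩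
    · exact nonpos_of_mul_nonpos_right h hθ
    · simpa using h
  exact NNReal.coe_eq_zero.1 (hx.antisymm x.coe_nonneg)

theorem IsKernel.half_one_sub_theta_pos (hB : IsKernel B θ δ ρ C) : 0 < (1 - θ) / 2 :=
  half_pos (sub_pos.2 hB.theta_lt_one)

theorem IsKernel.eq_zero_of_notMem (hB : IsKernel B θ δ ρ C) {x y : ℝ≥0}
    (h : (x, y) ∉ gammaRegion θ δ ρ) : B x y = 0 := by
  rw [← hB.support_eq] at h
  exact image_eq_zero_of_notMem_tsupport (f := fun p : ℝ≥0 × ℝ≥0 => B p.1 p.2) h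

theorem IsKernel.kernelb_nonneg (hB : IsKernel B θ δ ρ C) (x y : ℝ≥0) : 0 ≤ kernelb B x y :=
  div_nonneg (hB.nonneg x y) (by positivity)

theorem IsKernel.kernelb_symm (hB : IsKernel B θ δ ρ C) (x y : ℝ≥0) :
    kernelb B x y = kernelb B y x := by
  rw [kernelb, kernelb, hB.symm, mul_comm]

theorem IsKernel.continuousOn_kernelb (hB : IsKernel B θ δ ρ C) :
    ContinuousOn (fun p : ℝ≥0 × ℝ≥0 => kernelb B p.1 p.2) {0}ᶜ := by
  rintro ⟨x, y⟩ hxy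
  by_cases hmem : (x, y) ∈ gammaRegion θ δ ρ
  · have hx : x ≠ 0 := by
      rintro rfl
      exact hxy (Prod.ext rfl (eq_zero_of_zero_left_mem_gammaRegion hmem))
    have hy : y ≠ 0 := by
      rintro rfl
      exact hxy (Prod.ext (eq_zero_of_zero_right_mem_gammaRegion hB.theta_pos hmem) rfl)
    exact (hB.continuousOn _ hxy).div (by fun_prop)
      (mul_ne_zero (NNReal.coe_ne_zero.2 hx) (NNReal.coe_ne_zero.2 hy))
  · rw [← hB.support_eq, notMem_tsupport_iff_eventuallyEq] at hmem
    refine ((continuousAt_const (y := (0 : ℝ))).congr ?_).continuousWithinAt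
    filter_upwards [hmem] with p hp
    simp only [kernelb, hp, Pi.zero_apply, zero_div]

theorem IsKernel.kernelb_le (hB : IsKernel B θ δ ρ C) {x y : ℝ≥0}
    (h : (x, y) ∈ gammaRegion θ δ ρ) :
    kernelb B x y ≤ C * Real.exp ((x + y) / 2) / (x * y * (x + y)) := by
  by_cases hxy : (x, y) = (0, 0)
  · simp [kernelb, (Prod.mk.inj hxy).1]
  · rw [kernelb, mul_comm ((x : ℝ) * y) (x + y), ← div_div (C * _)]
    refine div_le_div_of_nonneg_right ((hB.le_diag x y h hxy).trans (hB.diag_le x y h hxy)) ?_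
    positivity

theorem IsKernel.kernelb_mul_sub_sq_le (hB : IsKernel B θ δ ρ C) {x y : ℝ≥0} (hx : (x : ℝ) ≤ δ)
    (hy : (y : ℝ) ≤ δ) : kernelb B x y * (x - y) ^ 2 ≤ C * Real.exp δ * ρ ^ 2 := by
  have hC := hB.const_pos
  by_cases hmem : (x, y) ∈ gammaRegion θ δ ρ
  · have hsq : ((x : ℝ) - y) ^ 2 ≤ ρ ^ 2 * (x * y * (x + y)) := by
      have habs := hmem.resolve_left fun h => h.1 ⟨hx, hy⟩
      calc ((x : ℝ) - y) ^ 2 ≤ (ρ * √(x * y * (x + y))) ^ 2 :=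
            sq_le_sq' (abs_le.1 habs.2).1 (abs_le.1 habs.2).2
        _ = ρ ^ 2 * (x * y * (x + y)) := by rw [mul_pow, Real.sq_sqrt (by positivity)]
    calc kernelb B x y * (x - y) ^ 2
        ≤ C * Real.exp ((x + y) / 2) / (x * y * (x + y)) * (ρ ^ 2 * (x * y * (x + y))) := by
          gcongr
          exact hB.kernelb_le hmem
      _ = C * Real.exp ((x + y) / 2) * ρ ^ 2 * (x * y * (x + y) / (x * y * (x + y))) := by ring
      _ ≤ C * Real.exp ((x + y) / 2) * ρ ^ 2 :=
          mul_le_of_le_one_right (by positivity) (div_self_le_one _)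
      _ ≤ C * Real.exp δ * ρ ^ 2 := by
          gcongr
          linarith
  · rw [kernelb, hB.eq_zero_of_notMem hmem, zero_div, zero_mul]
    positivity

theorem abs_exp_neg_sub_exp_neg_le {x y : ℝ} (hx : 0 ≤ x) (hy : 0 ≤ y) :
    |Real.exp (-x) - Real.exp (-y)| ≤ |x - y| := by
  have hderiv (z : ℝ) : HasDerivAt (fun z => Real.exp (-z)) (Real.exp (-z) * -1) z :=
    (hasDerivAt_neg z).exp
  simpa using (convex_Ici (0 : ℝ)).norm_image_sub_le_of_norm_hasDerivWithin_le (C := 1)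
    (fun z _ => (hderiv z).hasDerivWithinAt) (fun z hz => by simpa using hz) hy hx

theorem IsKernel.abs_kernelR_le_mul_abs_sub (hB : IsKernel B θ δ ρ C) (x y : ℝ≥0) :
    |kernelR B x y| ≤ kernelb B x y * |(x : ℝ) - y| := by
  rw [kernelR, abs_mul, abs_of_nonneg (hB.kernelb_nonneg x y)]
  exact mul_le_mul_of_nonneg_left (abs_exp_neg_sub_exp_neg_le x.coe_nonneg y.coe_nonneg)
    (hB.kernelb_nonneg x y)

theorem IsKernel.kernelR_swap (hB : IsKernel B θ δ ρ C) (x y : ℝ≥0) :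
    kernelR B y x = -kernelR B x y := by
  rw [kernelR, kernelR, hB.kernelb_symm]
  ring

theorem IsKernel.abs_kernelR_le_exp_max (hB : IsKernel B θ δ ρ C) {x y : ℝ≥0}
    (h : ¬((x : ℝ) ≤ δ ∧ (y : ℝ) ≤ δ)) :
    |kernelR B x y| ≤ C / (θ * δ * δ * δ) * Real.exp ((1 - θ) / 2 * max (x : ℝ) y) := by
  have hC := hB.const_pos
  have hδ := hB.delta_pos
  have hθ := hB.theta_pos
  wlog hxy : x ≤ y generalizing x y
  · have hswap := this (fun h' => h h'.symm) (le_of_not_ge hxy)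
    rwa [hB.kernelR_swap, abs_neg, max_comm] at hswap
  rw [max_eq_right (NNReal.coe_le_coe.2 hxy)]
  by_cases hmem : (x, y) ∈ gammaRegion θ δ ρ
  · have hcone : θ * y ≤ x := by
      have hle := (hmem.resolve_right fun h' => h h'.1).2.2
      rwa [inv_mul_eq_div, le_div_iff₀' hθ] at hle
    have hδy : δ ≤ y := by
      by_contra! hy
      exact h ⟨(NNReal.coe_le_coe.2 hxy).trans hy.le, hy.le⟩
    have hδx : θ * δ ≤ x := hcone.trans' (by gcongr)
    have hexp : |Real.exp (-(x : ℝ)) - Real.exp (-(y : ℝ))| ≤ Real.exp (-x) :=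
      abs_sub_le_of_nonneg_of_le (by positivity) le_rfl (by positivity) (by gcongr)
    calc |kernelR B x y|
        = kernelb B x y * |Real.exp (-(x : ℝ)) - Real.exp (-(y : ℝ))| := by
          rw [kernelR, abs_mul, abs_of_nonneg (hB.kernelb_nonneg x y)]
      _ ≤ C * Real.exp ((x + y) / 2) / (x * y * (x + y)) * Real.exp (-x) := by
          gcongr
          exact hB.kernelb_le hmem
      _ = C / (x * y * (x + y)) * Real.exp ((y - x) / 2) := by
          rw [show ((y : ℝ) - x) / 2 = (x + y) / 2 + -x by ring, Real.exp_add]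
          ring
      _ ≤ C / (θ * δ * δ * δ) * Real.exp ((1 - θ) / 2 * y) := by
          gcongr
          · linarith [x.coe_nonneg]
          · linarith
  · rw [kernelR, kernelb, hB.eq_zero_of_notMem hmem, zero_div, zero_mul, abs_zero]
    positivity

end Kernel

section ExpWeight

/-- The weight `x ↦ e^{ηx}` of the moment `X_η`. -/
def expWeight (η : ℝ) : C(ℝ≥0, ℝ≥0) where
  toFun x := (Real.exp (η * x)).toNNReal

variable {η : ℝ}

theorem coe_expWeight (η : ℝ) (x : ℝ≥0) : (expWeight η x : ℝ) = Real.exp (η * x) :=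
  Real.coe_toNNReal _ (Real.exp_nonneg _)

theorem expWeight_le_expWeight_iff (hη : 0 < η) {x y : ℝ≥0} :
    expWeight η x ≤ expWeight η y ↔ x ≤ y := by
  rw [← NNReal.coe_le_coe, coe_expWeight, coe_expWeight, Real.exp_le_exp, mul_le_mul_iff_right₀ hη,
    NNReal.coe_le_coe]

theorem isCompact_expWeight_le (hη : 0 < η) (N : ℕ) : IsCompact {x | expWeight η x ≤ N} := by
  refine (isCompact_Icc (a := 0) (b := (N / η).toNNReal)).of_isClosed_subset
    (isClosed_le (expWeight η).continuous continuous_const) fun x (hx : expWeight η x ≤ N) => ?_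
  refine ⟨zero_le, NNReal.le_toNNReal_of_coe_le ((le_div_iff₀' hη).2 ?_)⟩
  rw [← NNReal.coe_le_coe, coe_expWeight] at hx
  exact (Real.add_one_le_exp _).trans' (by simp) |>.trans hx

theorem exp_mul_max_le_expWeight_add (η : ℝ) (x y : ℝ≥0) :
    Real.exp (η * max (x : ℝ) y) ≤ expWeight η x + expWeight η y := by
  rw [coe_expWeight, coe_expWeight]
  rcases max_choice (x : ℝ) y with h | h <;> rw [h]
  · exact le_add_of_nonneg_right (Real.exp_nonneg _)
  · exact le_add_of_nonneg_left (Real.exp_nonneg _)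

theorem tendsto_max_coe_cocompact :
    Tendsto (fun p : ℝ≥0 × ℝ≥0 => max (p.1 : ℝ) p.2) (cocompact _) atTop := by
  refine (tendsto_dist_right_cocompact_atTop (0 : ℝ≥0 × ℝ≥0)).congr fun p => ?_
  simp [Prod.dist_eq, NNReal.dist_eq]

theorem isLittleO_exp_mul_max {κ : ℝ} (h : κ < η) :
    (fun p : ℝ≥0 × ℝ≥0 => Real.exp (κ * max (p.1 : ℝ) p.2)) =o[cocompact _]
      fun p => (expWeight η p.1 + expWeight η p.2 : ℝ) := by
  have hexp : (fun p : ℝ≥0 × ℝ≥0 => Real.exp (κ * max (p.1 : ℝ) p.2)) =o[cocompact _]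
      fun p => Real.exp (η * max (p.1 : ℝ) p.2) := by
    refine Real.isLittleO_exp_comp_exp_comp.2 ?_
    simp_rw [← sub_mul]
    exact tendsto_max_coe_cocompact.const_mul_atTop (sub_pos.2 h)
  refine hexp.trans_isBigO (isBigO_of_le _ fun p => ?_)
  rw [Real.norm_of_nonneg (Real.exp_nonneg _), Real.norm_of_nonneg (by positivity)]
  exact exp_mul_max_le_expWeight_add η p.1 p.2

end ExpWeight

section Truncation

theorem tendstoWeighted_of_isLittleO {Y : Type*} [TopologicalSpace Y] {F : ℕ → Y →ᵇ ℝ}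
    {G b W : Y → ℝ} {y₀ : Y} (hW : ∀ y, 0 ≤ W y) (hb : ContinuousOn b {y₀}ᶜ)
    (hG : G =o[𝓝 y₀ ⊔ cocompact Y] W) (hle : ∀ n y, |F n y - G y| ≤ |G y|)
    (heq : ∀ (n : ℕ) y, b y ≤ n → F n y = G y) : TendstoWeighted F G atTop W := by
  intro ε hε
  obtain ⟨hnear, hfar⟩ := eventually_sup.1 (isLittleO_iff.1 hG hε)
  obtain ⟨U, hsmall, hU, hy₀⟩ := eventually_nhds_iff.1 hnear
  obtain ⟨K, hK, hKfar⟩ := mem_cocompact.1 hfar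
  have hbK : BddAbove (b '' (K \ U)) := (hK.diff hU).bddAbove_image
    (hb.mono fun y hy h => hy.2 (mem_singleton_iff.1 h ▸ hy₀))
  obtain ⟨N, hN⟩ := hbK
  filter_upwards [eventually_ge_atTop ⌈N⌉₊] with n hn y
  have hεW (h : ‖G y‖ ≤ ε * ‖W y‖) : |F n y - G y| ≤ ε * W y :=
    (hle n y).trans (by rwa [Real.norm_of_nonneg (hW y)] at h)
  by_cases hyU : y ∈ U
  · exact hεW (hsmall y hyU)
  by_cases hyK : y ∈ K
  · have hby : b y ≤ n := (hN (mem_image_of_mem b ⟨hyK, hyU⟩)).trans (Nat.ceil_le.1 hn)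
    rw [heq n y hby, sub_self, abs_zero]
    exact mul_nonneg hε.le (hW y)
  · exact hεW (hKfar hyK)

variable {B : ℝ≥0 → ℝ≥0 → ℝ} {θ δ ρ C : ℝ}

theorem IsKernel.abs_min_kernelb_mul_le (hB : IsKernel B θ δ ρ C) (n : ℕ) (p : ℝ≥0 × ℝ≥0)
    (a : ℝ) : |min (kernelb B p.1 p.2) n * a| ≤ n * |a| := by
  rw [abs_mul, abs_of_nonneg (le_min (hB.kernelb_nonneg _ _) n.cast_nonneg)]
  gcongr
  exact min_le_right _ _

/-- The bounded rate `min(b(x, y), n) (e⁻ˣ - e⁻ʸ)`. -/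
def IsKernel.truncRate (hB : IsKernel B θ δ ρ C) (n : ℕ) : ℝ≥0 × ℝ≥0 →ᵇ ℝ :=
  .ofNormedAddCommGroup
    (fun p => min (kernelb B p.1 p.2) n * (Real.exp (-(p.1 : ℝ)) - Real.exp (-(p.2 : ℝ))))
    (by
      have hexp : Continuous fun p : ℝ≥0 × ℝ≥0 =>
          Real.exp (-(p.1 : ℝ)) - Real.exp (-(p.2 : ℝ)) := by fun_prop
      refine continuous_iff_continuousAt.2 fun p => ?_
      by_cases hp : p = 0
      · subst hp
        have hlim : Tendsto (fun p : ℝ≥0 × ℝ≥0 =>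
            n * |Real.exp (-(p.1 : ℝ)) - Real.exp (-(p.2 : ℝ))|) (𝓝 0) (𝓝 0) := by
          simpa using (hexp.abs.const_mul (n : ℝ)).tendsto 0
        simpa [ContinuousAt] using squeeze_zero_norm
          (fun p => hB.abs_min_kernelb_mul_le n p _) hlim
      · have hb := hB.continuousOn_kernelb.continuousAt (isOpen_compl_singleton.mem_nhds hp)
        exact (hb.min continuousAt_const).mul hexp.continuousAt)
    n fun p => by
      have hexp : |Real.exp (-(p.1 : ℝ)) - Real.exp (-(p.2 : ℝ))| ≤ 1 :=
        abs_sub_le_of_nonneg_of_le (Real.exp_nonneg _) (Real.exp_le_one_iff.2 (by simp))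
          (Real.exp_nonneg _) (Real.exp_le_one_iff.2 (by simp))
      exact (hB.abs_min_kernelb_mul_le n p _).trans (mul_le_of_le_one_right n.cast_nonneg hexp)

theorem IsKernel.truncRate_apply (hB : IsKernel B θ δ ρ C) (n : ℕ) (p : ℝ≥0 × ℝ≥0) :
    hB.truncRate n p =
      min (kernelb B p.1 p.2) n * (Real.exp (-(p.1 : ℝ)) - Real.exp (-(p.2 : ℝ))) := rfl

theorem IsKernel.norm_truncRate_le (hB : IsKernel B θ δ ρ C) (n : ℕ) : ‖hB.truncRate n‖ ≤ n :=
  BoundedContinuousFunction.norm_ofNormedAddCommGroup_le _ n.cast_nonneg _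

theorem IsKernel.truncRate_swap (hB : IsKernel B θ δ ρ C) (n : ℕ) (x y : ℝ≥0) :
    hB.truncRate n (y, x) = -hB.truncRate n (x, y) := by
  simp only [hB.truncRate_apply, hB.kernelb_symm y x]
  ring

theorem IsKernel.truncRate_nonneg (hB : IsKernel B θ δ ρ C) (n : ℕ) {x y : ℝ≥0} (h : x ≤ y) :
    0 ≤ hB.truncRate n (x, y) := by
  refine mul_nonneg (le_min (hB.kernelb_nonneg x y) n.cast_nonneg) (sub_nonneg.2 ?_)
  exact Real.exp_le_exp.2 (neg_le_neg (NNReal.coe_le_coe.2 h))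

theorem IsKernel.abs_truncRate_sub_kernelR_le (hB : IsKernel B θ δ ρ C) (n : ℕ)
    (p : ℝ≥0 × ℝ≥0) : |hB.truncRate n p - kernelR B p.1 p.2| ≤ |kernelR B p.1 p.2| := by
  have hmin : 0 ≤ min (kernelb B p.1 p.2) n := le_min (hB.kernelb_nonneg _ _) n.cast_nonneg
  have hb : |min (kernelb B p.1 p.2) n - kernelb B p.1 p.2| ≤ |kernelb B p.1 p.2| := by
    rw [abs_sub_comm, abs_of_nonneg (hB.kernelb_nonneg _ _),
      abs_of_nonneg (sub_nonneg.2 (min_le_left _ _))]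
    exact sub_le_self _ hmin
  rw [hB.truncRate_apply, kernelR, ← sub_mul, abs_mul, abs_mul]
  gcongr

variable {φ : ℝ → ℝ}

theorem IsKernel.collisionIntegrand_isLittleO_nhds_zero (hB : IsKernel B θ δ ρ C)
    (hφ : IsTestFunction φ) : collisionIntegrand B φ =o[𝓝 0] fun _ => (1 : ℝ) := by
  have hR : (fun p : ℝ≥0 × ℝ≥0 => kernelR B p.1 p.2) =O[𝓝 0]
      fun p => kernelb B p.1 p.2 * (p.1 - p.2) := isBigO_of_le _ fun p => by
    rw [norm_mul, Real.norm_of_nonneg (hB.kernelb_nonneg _ _)]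
    exact hB.abs_kernelR_le_mul_abs_sub p.1 p.2
  refine (hR.mul_isLittleO hφ.isLittleO_sub).trans_isBigO
    (.of_bound (C * Real.exp δ * ρ ^ 2) ?_)
  filter_upwards [eventually_coe_le_nhds_zero hB.delta_pos] with p ⟨hp₁, hp₂⟩
  rw [mul_assoc, ← sq, norm_one, mul_one,
    Real.norm_of_nonneg (mul_nonneg (hB.kernelb_nonneg _ _) (sq_nonneg _))]
  exact hB.kernelb_mul_sub_sq_le hp₁ hp₂

theorem IsKernel.kernelR_isBigO_cocompact (hB : IsKernel B θ δ ρ C) :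
    (fun p : ℝ≥0 × ℝ≥0 => kernelR B p.1 p.2) =O[cocompact _]
      fun p => Real.exp ((1 - θ) / 2 * max (p.1 : ℝ) p.2) := by
  refine .of_bound (C / (θ * δ * δ * δ)) ?_
  filter_upwards [tendsto_max_coe_cocompact.eventually_gt_atTop δ] with p hp
  rw [Real.norm_of_nonneg (Real.exp_nonneg _)]
  exact hB.abs_kernelR_le_exp_max fun h => hp.not_ge (max_le h.1 h.2)

theorem IsKernel.collisionIntegrand_isLittleO_cocompact (hB : IsKernel B θ δ ρ C)
    (hφ : IsC1b φ) {η : ℝ} (hη : (1 - θ) / 2 < η) :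
    collisionIntegrand B φ =o[cocompact _] fun p => (expWeight η p.1 + expWeight η p.2 : ℝ) := by
  obtain ⟨M, hM⟩ := hφ.bounded
  have hsub : (fun p : ℝ≥0 × ℝ≥0 => φ p.1 - φ p.2) =O[cocompact _] fun _ => (1 : ℝ) :=
    .of_bound (M + M) (Eventually.of_forall fun p => by
      rw [norm_one, mul_one]
      exact norm_sub_le_of_le (hM p.1 p.1.coe_nonneg) (hM p.2 p.2.coe_nonneg))
  have hprod :=
    (hB.kernelR_isBigO_cocompact.trans_isLittleO (isLittleO_exp_mul_max hη)).mul_isBigO hsub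
  simp only [mul_one] at hprod
  exact hprod

theorem IsKernel.tendstoWeighted_collision (hB : IsKernel B θ δ ρ C) (hφ : IsTestFunction φ)
    {η : ℝ} (hη : (1 - θ) / 2 < η) :
    TendstoWeighted (fun n => collision (hB.truncRate n) hφ.restrict) (collisionIntegrand B φ) atTop
      fun p => expWeight η p.1 + expWeight η p.2 := by
  have hη₀ : 0 ≤ η := (hB.half_one_sub_theta_pos.trans hη).le
  have hone : (fun _ => (1 : ℝ)) =O[𝓝 0]
      fun p : ℝ≥0 × ℝ≥0 => (expWeight η p.1 + expWeight η p.2 : ℝ) := isBigO_of_le _ fun p => by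
    rw [norm_one, Real.norm_of_nonneg (by positivity)]
    exact (Real.one_le_exp (by positivity)).trans (exp_mul_max_le_expWeight_add η p.1 p.2)
  refine tendstoWeighted_of_isLittleO (y₀ := 0) (fun p => by positivity) hB.continuousOn_kernelb
    (((hB.collisionIntegrand_isLittleO_nhds_zero hφ).trans_isBigO hone).sup
      (hB.collisionIntegrand_isLittleO_cocompact hφ.toIsC1b hη)) (fun n p => ?_)
    fun n p hn => ?_
  · change |hB.truncRate n p * (φ p.1 - φ p.2) - kernelR B p.1 p.2 * (φ p.1 - φ p.2)| ≤
      |kernelR B p.1 p.2 * (φ p.1 - φ p.2)|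
    rw [← sub_mul, abs_mul, abs_mul]
    exact mul_le_mul_of_nonneg_right (hB.abs_truncRate_sub_kernelR_le n p) (abs_nonneg _)
  · change hB.truncRate n p * (φ p.1 - φ p.2) = kernelR B p.1 p.2 * (φ p.1 - φ p.2)
    rw [hB.truncRate_apply, min_eq_left hn, kernelR]

end Truncation

section WeakSolutions

variable {f g : ℝ → ℝ}

theorem memLinftyLoc_of_continuous (hf : Continuous f) : MemLinftyLoc f := fun T _ => by
  obtain ⟨L, hL⟩ := (isCompact_Icc (a := 0) (b := T)).exists_bound_of_continuousOn hf.continuousOn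
  refine memLp_top_of_bound hf.aestronglyMeasurable L ?_
  filter_upwards [ae_restrict_mem measurableSet_Ioo] with t ht using hL t (Ioo_subset_Icc_self ht)

theorem isWeakDeriv_of_hasDerivAt (hf : Continuous f) (hg : Continuous g)
    (hfg : ∀ t > 0, HasDerivAt f (g t) t) : IsWeakDeriv f g := by
  intro ψ hψ hcompact hsupp
  have hψ' : Continuous (deriv ψ) := hψ.continuous_deriv (by simp)
  have hψ₀ : ψ 0 = 0 := image_eq_zero_of_notMem_tsupport fun h => lt_irrefl (0 : ℝ) (hsupp h)
  have hzero : Tendsto (f * ψ) (𝓝[>] 0) (𝓝 0) :=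
    ((hf.mul hψ.continuous).tendsto' 0 0 (by simp [hψ₀])).mono_left nhdsWithin_le_nhds
  have htop : Tendsto (f * ψ) atTop (𝓝 0) := by
    have hψtop := (hasCompactSupport_iff_eventuallyEq.1 hcompact).filter_mono
      (coclosedCompact_eq_cocompact (X := ℝ) ▸ atTop_le_cocompact)
    refine tendsto_const_nhds.congr' ?_
    filter_upwards [hψtop] with t ht
    simp [ht]
  have hparts := integral_Ioi_mul_deriv_eq_deriv_mul hfg
    (fun t _ => (hψ.differentiable (by simp) t).hasDerivAt)
    ((hf.mul hψ').integrable_of_hasCompactSupport hcompact.deriv.mul_left).integrableOn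
    ((hg.mul hψ.continuous).integrable_of_hasCompactSupport hcompact.mul_left).integrableOn
    hzero htop
  simpa using hparts

theorem memW1inftyLoc_of_hasDerivAt (hf : Continuous f) (hg : Continuous g)
    (hfg : ∀ t > 0, HasDerivAt f (g t) t) : MemW1inftyLoc f :=
  ⟨memLinftyLoc_of_continuous hf, g, memLinftyLoc_of_continuous hg,
    isWeakDeriv_of_hasDerivAt hf hg hfg⟩

theorem isWeakSolution_of_hasDerivAt {B : ℝ≥0 → ℝ≥0 → ℝ} {u₀ : FiniteMeasure ℝ≥0}
    {u : ℝ≥0 → FiniteMeasure ℝ≥0} (hu : Continuous u) (hu₀ : u 0 = u₀)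
    (hint : ∀ φ, IsTestFunction φ → ∀ t,
      Integrable (collisionIntegrand B φ) ((u t : Measure ℝ≥0).prod (u t : Measure ℝ≥0)))
    (hcont : ∀ φ, IsTestFunction φ → Continuous fun t => quadForm (collisionIntegrand B φ) (u t))
    (hderiv : ∀ φ, IsTestFunction φ → ∀ t > 0,
      HasDerivAt (pairing u φ) (quadForm (collisionIntegrand B φ) (u t.toNNReal)) t) :
    IsWeakSolution B u₀ u where
  continuous_integral φ :=
    (FiniteMeasure.continuous_integral_boundedContinuousFunction φ).comp hu
  initial φ := by rw [hu₀]
  memW1inftyLoc φ hφ hφ₀ :=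
    memW1inftyLoc_of_hasDerivAt
      ((FiniteMeasure.continuous_integral_boundedContinuousFunction hφ.restrict).comp
        (hu.comp continuous_real_toNNReal))
      ((hcont φ ⟨hφ, hφ₀⟩).comp continuous_real_toNNReal) (hderiv φ ⟨hφ, hφ₀⟩)
  equation φ hφ hφ₀ := by
    filter_upwards [ae_restrict_mem measurableSet_Ioi] with t ht
    exact ⟨hint φ ⟨hφ, hφ₀⟩ _, hderiv φ ⟨hφ, hφ₀⟩ t ht⟩

end WeakSolutions

section Scheme

/-- The length of the time steps of the `n`-th Euler scheme, for measures of mass `M`: small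
enough, relative to the bound `n` on the rate, for the Euler densities to be nonnegative. -/
def stepSize (M : ℝ≥0) (n : ℕ) : ℝ := 1 / ((n + 1) * (M + 1))

theorem stepSize_pos (M : ℝ≥0) (n : ℕ) : 0 < stepSize M n := by
  unfold stepSize
  positivity

theorem stepSize_mul_le (M : ℝ≥0) (n : ℕ) : stepSize M n * n * M ≤ 1 := by
  rw [mul_assoc, stepSize, one_div_mul_eq_div, div_le_one (by positivity)]
  gcongr <;> simp

theorem tendsto_stepSize (M : ℝ≥0) : Tendsto (stepSize M) atTop (𝓝 0) := by
  have hlim := (tendsto_one_div_add_atTop_nhds_zero_nat (𝕜 := ℝ)).mul_const (1 / ((M : ℝ) + 1))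
  rw [zero_mul] at hlim
  exact hlim.congr fun n => one_div_mul_one_div _ _

variable {B : ℝ≥0 → ℝ≥0 → ℝ} {θ δ ρ C : ℝ}

/-- The rate per time step of the `n`-th Euler scheme, for measures of mass `M`. -/
def IsKernel.stepRate (hB : IsKernel B θ δ ρ C) (M : ℝ≥0) (n : ℕ) : ℝ≥0 × ℝ≥0 →ᵇ ℝ :=
  stepSize M n • hB.truncRate n

theorem IsKernel.norm_stepRate_mul_le (hB : IsKernel B θ δ ρ C) (M : ℝ≥0) (n : ℕ) :
    ‖hB.stepRate M n‖ * M ≤ 1 := by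
  rw [stepRate, norm_smul, Real.norm_of_nonneg (stepSize_pos M n).le]
  refine le_trans ?_ (stepSize_mul_le M n)
  gcongr
  · exact (stepSize_pos M n).le
  · exact hB.norm_truncRate_le n

theorem IsKernel.stepRate_swap (hB : IsKernel B θ δ ρ C) (M : ℝ≥0) (n : ℕ) (x y : ℝ≥0) :
    hB.stepRate M n (y, x) = -hB.stepRate M n (x, y) := by
  simp only [stepRate, BoundedContinuousFunction.coe_smul, hB.truncRate_swap n x y, smul_neg]

theorem IsKernel.quadForm_collision_stepRate (hB : IsKernel B θ δ ρ C) (M : ℝ≥0) (n : ℕ)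
    (f : ℝ≥0 →ᵇ ℝ) (μ : FiniteMeasure ℝ≥0) :
    quadForm (collision (hB.stepRate M n) f) μ =
      stepSize M n * quadForm (collision (hB.truncRate n) f) μ := by
  simp only [quadForm, collision_apply, stepRate, BoundedContinuousFunction.coe_smul, smul_eq_mul,
    mul_assoc, integral_const_mul]
  ring

/-- The `k`-th iterate of the Euler scheme for the rate truncated at height `n`. -/
def IsKernel.scheme (hB : IsKernel B θ δ ρ C) (u₀ : FiniteMeasure ℝ≥0) (n k : ℕ) :
    FiniteMeasure ℝ≥0 :=
  (eulerStep (hB.stepRate u₀.mass n))^[k] u₀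

theorem IsKernel.scheme_succ (hB : IsKernel B θ δ ρ C) (u₀ : FiniteMeasure ℝ≥0) (n k : ℕ) :
    hB.scheme u₀ n (k + 1) = eulerStep (hB.stepRate u₀.mass n) (hB.scheme u₀ n k) :=
  Function.iterate_succ_apply' _ _ _

variable {η : ℝ} {u₀ : FiniteMeasure ℝ≥0} {c : ℝ≥0}

theorem IsKernel.scheme_mem_momentSet (hB : IsKernel B θ δ ρ C) (hη : 0 < η)
    (hu₀ : expMoment η u₀ ≤ c) (n k : ℕ) :
    hB.scheme u₀ n k ∈ momentSet (expWeight η) u₀.mass c := by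
  induction k with
  | zero => exact ⟨rfl, hu₀⟩
  | succ k ih =>
    rw [hB.scheme_succ]
    refine eulerStep_mem_momentSet (hB.stepRate_swap _ n) (fun x y hxy => ?_)
      (hB.norm_stepRate_mul_le _ n) ih
    exact mul_nonneg (stepSize_pos _ n).le
      (hB.truncRate_nonneg n ((expWeight_le_expWeight_iff hη).1 hxy.le))

theorem IsKernel.isConsistent_scheme (hB : IsKernel B θ δ ρ C) {φ : ℝ → ℝ}
    (hφ : IsTestFunction φ) (hη : (1 - θ) / 2 < η) (hu₀ : expMoment η u₀ ≤ c) :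
    IsConsistent atTop (stepSize u₀.mass) (hB.scheme u₀)
      (fun μ => ∫ x, hφ.restrict x ∂(μ : Measure ℝ≥0)) (quadForm (collisionIntegrand B φ)) := by
  intro ε hε
  have hη₀ : 0 < η := hB.half_one_sub_theta_pos.trans hη
  have hunif := (hB.tendstoWeighted_collision hφ hη).tendstoUniformlyOn_quadForm u₀.mass c
  filter_upwards [Metric.tendstoUniformlyOn_iff.1 hunif ε hε] with n hn k
  have hmem := hB.scheme_mem_momentSet hη₀ hu₀ n k
  have hbound := hn _ hmem
  rw [dist_comm, Real.dist_eq] at hbound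
  rw [hB.scheme_succ, integral_eulerStep (hB.stepRate_swap _ n)
    (hmem.1 ▸ hB.norm_stepRate_mul_le _ n), add_sub_cancel_left, hB.quadForm_collision_stepRate,
    ← mul_sub, abs_mul, abs_of_pos (stepSize_pos _ n), mul_comm]
  exact mul_le_mul_of_nonneg_right hbound.le (stepSize_pos _ n).le

end Scheme

end Compton

end

theorem theorem5p1 (B : ℝ≥0 → ℝ≥0 → ℝ) (θ δ ρ C : ℝ) (hB : Compton.IsKernel B θ δ ρ C)
    (u₀ : FiniteMeasure ℝ≥0) (η : ℝ) (hη : (1 - θ) / 2 < η)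
    (hu₀ : Compton.expMoment η u₀ < ⊤) :
    ∃ u : ℝ≥0 → FiniteMeasure ℝ≥0,
      Continuous u ∧
      Compton.IsWeakSolution B u₀ u ∧
      (∀ t : ℝ≥0, (u t).mass = u₀.mass) ∧
      (∀ t : ℝ≥0, Compton.expMoment η (u t) ≤ Compton.expMoment η u₀) := by
  have hη₀ : 0 < η := hB.half_one_sub_theta_pos.trans hη
  lift Compton.expMoment η u₀ to ℝ≥0 using hu₀.ne with c hc
  have hlim {φ : ℝ → ℝ} (hφ : Compton.IsTestFunction φ) := hB.tendstoWeighted_collision hφ hη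
  obtain ⟨u, hu, hu_zero, hu_mem, hderiv⟩ := Compton.exists_limit_curve_of_isConsistent
    (ι := {φ // Compton.IsTestFunction φ})
    (Compton.isCompact_momentSet (Compton.isCompact_expWeight_le hη₀) u₀.mass c)
    (fun φ => FiniteMeasure.continuous_integral_boundedContinuousFunction φ.2.restrict)
    (fun μ _ ν _ h => Compton.finiteMeasure_ext_of_integral_isTestFunction fun φ hφ =>
      congrFun h ⟨φ, hφ⟩)
    (fun φ => (hlim φ.2).continuousOn_quadForm u₀.mass c)
    (hB.scheme_mem_momentSet hη₀ hc.ge) (Compton.stepSize_pos u₀.mass)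
    (Compton.tendsto_stepSize u₀.mass) (fun φ => hB.isConsistent_scheme φ.2 hη hc.ge)
    (fun _ => rfl)
  refine ⟨u, hu, Compton.isWeakSolution_of_hasDerivAt hu hu_zero (fun φ hφ t => ?_)
    (fun φ hφ => ?_) (fun φ hφ => hderiv ⟨φ, hφ⟩), fun t => (hu_mem t).1,
    fun t => (hu_mem t).2⟩
  · exact (hlim hφ).integrable
      (Compton.integrable_fst_add_snd ((hu_mem t).2.trans_lt ENNReal.coe_lt_top).ne)
  · exact ((hlim hφ).continuousOn_quadForm u₀.mass c).comp_continuous hu hu_mem
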